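/- Let $X = a\,\partial_x + b\,\partial_y$, $a,b\in\mathbb C[x,y]$, be a polynomial vector field of degree $d=\max(\deg a,\deg b)$ on $\mathbb C^2$. A nonconstant $f\in\mathbb C[x,y]$ is an invariant algebraic curve of $X$ if $f$ divides $X(f)=af_x+bf_y$. For an invariant algebraic curve $f$ and $l\ge 1$, the $l$-geometric multiplicity $\mu_{g,l}(X,f)\in\mathbb N\cup\{\infty\}$ is the supremum of the integers $m\ge 0$ for which there is a sequence of vector fields $X_k$ of degree $d$ converging to $X$ such that every $X_k$ has $m$ invariant algebraic curves $f_k^{(1)},\dots,f_k^{(m)}$ of degree at most $l$, pairwise without common factors, with $f_k^{(i)}\to f$ as $k\to\infty$ for each $i$ (convergence means convergence of coefficients). Let $a_d,b_d$ be the homogeneous parts of degree $d$ of $a,b$; the line at infinity is invariant by $X$ if $xb_d-ya_d\neq 0$. Put $$ n_l(X)=\begin{cases}\dfrac{d(l^4+6l^3+11l^2+6l)-l^4-2l^3+l^2-6l}{8}, & \text{if the line at infinity is invariant},\\[2mm] \dfrac{d(l^4+6l^3+11l^2+6l)-2l^4-8l^3-10l^2-4l}{8}, & \text{otherwise}.\end{cases}$$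 Let $f_1,\dots,f_p$ be invariant algebraic curves of $X$, pairwise without common factors. If for some positive integer $l$ $$\sum_{j=1}^p \deg(f_j)\,\mu_{g,l}(X,f_j) > n_l(X),$$ or if $l\ge 2$, the line at infinity is invariant and $\sum_{j=1}^p \deg(f_j)\,\mu_{g,l}(X,f_j) \ge n_l(X)$, then $X$ admits a rational first integral, that is, a nonconstant rational function $H$ with $X(H)=0$. -/

import Mathlib

open MvPolynomial Filter Topology
open scoped ENNReal

noncomputable section

/-- A polynomial vector field `a ∂/∂x + b ∂/∂y` on `ℂ²`; the variables `x`, `y` are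
`X 0`, `X 1` in `MvPolynomial (Fin 2) ℂ`. -/
structure PlaneVectorField where
  a : MvPolynomial (Fin 2) ℂ
  b : MvPolynomial (Fin 2) ℂ

namespace PlaneVectorField

/-- The (affine) degree: the maximum of the degrees of the two components. -/
def degree (V : PlaneVectorField) : ℕ := max V.a.totalDegree V.b.totalDegree

/-- The action of the vector field on polynomials: `V(f) = a f_x + b f_y`. -/
def apply (V : PlaneVectorField) (f : MvPolynomial (Fin 2) ℂ) : MvPolynomial (Fin 2) ℂ :=
  V.a * pderiv 0 f + V.b * pderiv 1 f

/-- `f` defines an invariant algebraic curve of `V`: `f` is a nonconstant polynomial and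
`V(f) / f` is a polynomial. -/
def IsInvariantCurve (V : PlaneVectorField) (f : MvPolynomial (Fin 2) ℂ) : Prop :=
  0 < f.totalDegree ∧ f ∣ V.apply f

/-- Convergence of a sequence of polynomials, coefficient by coefficient. -/
def _root_.PolyTendsto (F : ℕ → MvPolynomial (Fin 2) ℂ) (f : MvPolynomial (Fin 2) ℂ) : Prop :=
  ∀ s : Fin 2 →₀ ℕ, Tendsto (fun k => coeff s (F k)) atTop (𝓝 (coeff s f))

/-- There is a sequence of vector fields `W k`, of the same degree as `V`, converging to `V`,
such that each `W k` has `m` invariant algebraic curves `g k 1, …, g k m` of degree at most `l`,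
pairwise without common factors, each of which converges to `f` as `k → ∞`. -/
def HasGeomMultiplicity (V : PlaneVectorField) (f : MvPolynomial (Fin 2) ℂ) (l m : ℕ) : Prop :=
  ∃ (W : ℕ → PlaneVectorField) (g : ℕ → Fin m → MvPolynomial (Fin 2) ℂ),
    (∀ k, (W k).degree = V.degree) ∧
    PolyTendsto (fun k => (W k).a) V.a ∧
    PolyTendsto (fun k => (W k).b) V.b ∧
    (∀ k i, (W k).IsInvariantCurve (g k i) ∧ (g k i).totalDegree ≤ l) ∧
    (∀ k, Pairwise fun i j => IsRelPrime (g k i) (g k j)) ∧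
    ∀ i, PolyTendsto (fun k => g k i) f

/-- The `l`-geometric multiplicity of the invariant curve `f` of `V`: the supremum of the numbers
`m` of curves occurring above. It may be infinite. -/
def geomMultiplicity (V : PlaneVectorField) (l : ℕ) (f : MvPolynomial (Fin 2) ℂ) : ℕ∞ :=
  ⨆ (m : ℕ) (_ : V.HasGeomMultiplicity f l m), (m : ℕ∞)

/-- The line at infinity is invariant by `V`: `x b_d - y a_d ≠ 0`, where `d` is the degree of `V`
and `a_d`, `b_d` are the homogeneous parts of degree `d` of the components. -/
def LineAtInfinityInvariant (V : PlaneVectorField) : Prop :=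
  X 0 * homogeneousComponent V.degree V.b - X 1 * homogeneousComponent V.degree V.a ≠ 0

open Classical in
/-- The number `n_l(V)`. -/
def nBound (V : PlaneVectorField) (l : ℕ) : ℝ :=
  if V.LineAtInfinityInvariant then
    ((V.degree : ℝ) * ((l : ℝ) ^ 4 + 6 * (l : ℝ) ^ 3 + 11 * (l : ℝ) ^ 2 + 6 * (l : ℝ))
      - (l : ℝ) ^ 4 - 2 * (l : ℝ) ^ 3 + (l : ℝ) ^ 2 - 6 * (l : ℝ)) / 8
  else
    ((V.degree : ℝ) * ((l : ℝ) ^ 4 + 6 * (l : ℝ) ^ 3 + 11 * (l : ℝ) ^ 2 + 6 * (l : ℝ))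
      - 2 * (l : ℝ) ^ 4 - 8 * (l : ℝ) ^ 3 - 10 * (l : ℝ) ^ 2 - 4 * (l : ℝ)) / 8

/-- `V` admits a rational first integral: there is a nonconstant rational function `H = P / Q`
with `V(H) = (Q V(P) - P V(Q)) / Q² = 0`. -/
def HasRationalFirstIntegral (V : PlaneVectorField) : Prop :=
  ∃ P Q : MvPolynomial (Fin 2) ℂ, Q ≠ 0 ∧ (∀ c : ℂ, P ≠ C c * Q) ∧
    Q * V.apply P - P * V.apply Q = 0

end PlaneVectorField

end

/-! The proof rests on the extactic polynomial E_l(V), the determinant of the matrix with entries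
V^i(m_j), where m_j runs over the N monomials of degree at most l and 0 ≤ i < N. An invariant curve
of degree at most l is a constant combination of the m_j, so it divides E_l (`dvd_extactic`). When m
coprime invariant curves of nearby fields W_k merge into f, their product divides E_l(W_k); since
E_l depends continuously on the field, f^m divides E_l(V) in the limit (`pow_dvd_extactic`). Hence,
if E_l(V) ≠ 0, the weighted sum of multiplicities is at most deg E_l(V). That degree is at most
n_l(V), with strict inequality when l ≥ 2 and the line at infinity is invariant
(`totalDegree_extactic_le_nBound`). The hypothesis therefore forces E_l(V) = 0, and the resulting
dependence between the columns yields a rational first integral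
(`hasRationalFirstIntegral_of_extactic_eq_zero`). -/

/-! ### Degree filtration and the action of a vector field on it. -/

/-- Polynomials in two variables of total degree at most `n`, where `n` may be negative (in which
case only the zero polynomial qualifies). -/
noncomputable def degLE (n : ℤ) : Submodule ℂ (MvPolynomial (Fin 2) ℂ) :=
  restrictSupport ℂ {s | (s.degree : ℤ) ≤ n}

lemma mem_degLE {n : ℤ} {p : MvPolynomial (Fin 2) ℂ} :
    p ∈ degLE n ↔ ∀ s, coeff s p ≠ 0 → (s.degree : ℤ) ≤ n := by
  simp [degLE, mem_restrictSupport_iff, Set.subset_def]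

lemma mem_degLE_of_totalDegree_le {p : MvPolynomial (Fin 2) ℂ} {n : ℕ}
    (h : p.totalDegree ≤ n) : p ∈ degLE n :=
  mem_degLE.2 fun s hs => by
    have h1 : s.degree ≤ p.totalDegree := le_totalDegree (mem_support_iff.2 hs)
    exact_mod_cast h1.trans h

lemma totalDegree_le_of_mem_degLE {p : MvPolynomial (Fin 2) ℂ} {n : ℤ} (h : p ∈ degLE n)
    (hp : p ≠ 0) : (p.totalDegree : ℤ) ≤ n := by
  obtain ⟨s, hs, h'⟩ := p.support.exists_mem_eq_sup (support_nonempty.2 hp)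
    (fun s => s.sum fun _ e => e)
  have h1 := mem_degLE.1 h s (mem_support_iff.1 hs)
  have h2 : p.totalDegree = s.degree := h'
  rwa [h2]

lemma mul_mem_degLE {m n : ℤ} {p q : MvPolynomial (Fin 2) ℂ} (hp : p ∈ degLE m)
    (hq : q ∈ degLE n) : p * q ∈ degLE (m + n) := by
  classical
  refine mem_degLE.2 fun s hs => ?_
  rw [coeff_mul] at hs
  obtain ⟨x, hx, h⟩ := Finset.exists_ne_zero_of_sum_ne_zero hs
  rw [← Finset.HasAntidiagonal.mem_antidiagonal.1 hx, map_add]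
  have := mem_degLE.1 hp x.1 (left_ne_zero_of_mul h)
  have := mem_degLE.1 hq x.2 (right_ne_zero_of_mul h)
  push_cast
  linarith

lemma one_mem_degLE : (1 : MvPolynomial (Fin 2) ℂ) ∈ degLE 0 := by
  simpa using mem_degLE_of_totalDegree_le (p := 1) (n := 0) (by simp)

lemma prod_mem_degLE {ι : Type*} (s : Finset ι) {p : ι → MvPolynomial (Fin 2) ℂ} {n : ι → ℤ}
    (h : ∀ i ∈ s, p i ∈ degLE (n i)) : ∏ i ∈ s, p i ∈ degLE (∑ i ∈ s, n i) := by
  classical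
  induction s using Finset.induction_on with
  | empty => simpa using one_mem_degLE
  | insert i s hi ih =>
    rw [Finset.prod_insert hi, Finset.sum_insert hi]
    exact mul_mem_degLE (h i (by simp)) (ih fun j hj => h j (by simp [hj]))

lemma det_mem_degLE {ι : Type*} [Fintype ι] [DecidableEq ι]
    {A : Matrix ι ι (MvPolynomial (Fin 2) ℂ)} {r c : ι → ℤ}
    (h : ∀ i j, A i j ∈ degLE (r i + c j)) : A.det ∈ degLE (∑ i, r i + ∑ j, c j) := by
  rw [Matrix.det_apply]
  refine Submodule.sum_mem _ fun σ _ => ?_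
  have key : ∏ i, A (σ i) i ∈ degLE (∑ i, r i + ∑ j, c j) := by
    rw [← Equiv.sum_comp σ r, ← Finset.sum_add_distrib]
    exact prod_mem_degLE _ fun i _ => h _ _
  rcases Int.units_eq_one_or (Equiv.Perm.sign σ) with h | h <;> rw [h]
  · simpa using key
  · simpa using key

lemma pderiv_mem_degLE {n : ℤ} {p : MvPolynomial (Fin 2) ℂ} (hp : p ∈ degLE n) (i : Fin 2) :
    pderiv i p ∈ degLE (n - 1) := by
  refine mem_degLE.2 fun s hs => ?_
  rw [coeff_pderiv] at hs
  have := mem_degLE.1 hp _ (left_ne_zero_of_mul hs)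
  rw [map_add, Finsupp.degree_single] at this
  push_cast at this
  linarith

lemma coeff_X_mul_pderiv (p : MvPolynomial (Fin 2) ℂ) (i : Fin 2) (s : Fin 2 →₀ ℕ) :
    coeff s (X i * pderiv i p) = s i * coeff s p := by
  induction p using MvPolynomial.induction_on' with
  | add p q hp hq => simp [mul_add, hp, hq]
  | monomial m r =>
    rw [X_mul_pderiv_monomial, coeff_smul, nsmul_eq_mul, coeff_monomial]
    split_ifs with h <;> simp [h]

/-- The Euler operator multiplies a monomial of degree k by k, so subtracting `n` kills the part of
degree n. Lower terms do no harm, so `n` need only bound the degree; the row reduction below depends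
on this. -/
lemma euler_mem_degLE {n : ℤ} {p : MvPolynomial (Fin 2) ℂ} (hp : p ∈ degLE n) :
    X 0 * pderiv 0 p + X 1 * pderiv 1 p - (n : MvPolynomial (Fin 2) ℂ) * p ∈ degLE (n - 1) := by
  refine mem_degLE.2 fun s hs => ?_
  have e : (n : MvPolynomial (Fin 2) ℂ) = C (n : ℂ) := by simp
  rw [coeff_sub, coeff_add, coeff_X_mul_pderiv, coeff_X_mul_pderiv, e, coeff_C_mul, ← add_mul,
    ← sub_mul] at hs
  have h1 := mem_degLE.1 hp s (right_ne_zero_of_mul hs)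
  have h2 : (s.degree : ℤ) ≠ n := by
    rintro rfl
    apply left_ne_zero_of_mul hs
    simp [Finsupp.degree_eq_sum, Fin.sum_univ_two]
  omega

namespace PlaneVectorField

lemma a_mem_degLE (V : PlaneVectorField) : V.a ∈ degLE V.degree :=
  mem_degLE_of_totalDegree_le (le_max_left _ _)

lemma b_mem_degLE (V : PlaneVectorField) : V.b ∈ degLE V.degree :=
  mem_degLE_of_totalDegree_le (le_max_right _ _)

lemma apply_mem_degLE (V : PlaneVectorField) {n : ℤ} {p : MvPolynomial (Fin 2) ℂ}
    (hp : p ∈ degLE n) : V.apply p ∈ degLE (n + (V.degree - 1)) := by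
  have e : n + ((V.degree : ℤ) - 1) = V.degree + (n - 1) := by ring
  rw [e]
  exact add_mem (mul_mem_degLE V.a_mem_degLE (pderiv_mem_degLE hp 0))
    (mul_mem_degLE V.b_mem_degLE (pderiv_mem_degLE hp 1))

lemma iterate_apply_mem_degLE (V : PlaneVectorField) {n : ℤ} {p : MvPolynomial (Fin 2) ℂ}
    (hp : p ∈ degLE n) (i : ℕ) : V.apply^[i] p ∈ degLE (i * (V.degree - 1) + n) := by
  induction i with
  | zero => simpa using hp
  | succ i ih =>
    rw [Function.iterate_succ_apply']
    convert V.apply_mem_degLE ih using 2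
    push_cast
    ring

/-- If the line at infinity is not invariant, the leading part of the vector field is a multiple of
the radial vector field. -/
lemma exists_radial_part (V : PlaneVectorField) (hV : ¬ V.LineAtInfinityInvariant) :
    ∃ h ∈ degLE (V.degree - 1), V.a - X 0 * h ∈ degLE (V.degree - 1) ∧
      V.b - X 1 * h ∈ degLE (V.degree - 1) := by
  have top : ∀ p : MvPolynomial (Fin 2) ℂ, p ∈ degLE V.degree →
      p - homogeneousComponent V.degree p ∈ degLE (V.degree - 1) := fun p hp => by
    refine mem_degLE.2 fun s hs => ?_
    rw [coeff_sub, coeff_homogeneousComponent] at hs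
    split_ifs at hs with h
    · simp at hs
    · have := mem_degLE.1 hp s (by simpa using hs)
      omega
  simp only [LineAtInfinityInvariant, not_not, sub_eq_zero] at hV
  have hdvd : (X 0 : MvPolynomial (Fin 2) ℂ) ∣ homogeneousComponent V.degree V.a := by
    have h1 : (X 0 : MvPolynomial (Fin 2) ℂ) ∣ X 1 * homogeneousComponent V.degree V.a :=
      ⟨_, hV.symm⟩
    refine (X_prime.dvd_or_dvd h1).resolve_left fun h => ?_
    rw [X_dvd_X] at h
    simp at h
  obtain ⟨h, hh⟩ := hdvd
  have hb : homogeneousComponent V.degree V.b = X 1 * h := by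
    rw [hh, mul_left_comm] at hV
    exact mul_left_cancel₀ (X_ne_zero 0) hV
  refine ⟨h, ?_, hh ▸ top _ V.a_mem_degLE, hb ▸ top _ V.b_mem_degLE⟩
  refine mem_degLE.2 fun s hs => ?_
  -- The coefficients of `h` are those of x h = a_d shifted by one, so they sit in degree d - 1.
  rw [← coeff_X_mul s 0 h, ← hh, coeff_homogeneousComponent] at hs
  split_ifs at hs with h
  · rw [map_add, Finsupp.degree_single] at h
    omega
  · simp at hs

/-- Up to terms of degree at most d - 1 the field is `h` times the Euler field, which multiplies the
degree-n part of `p` by `n * h`. Removing this gains one degree over `apply_mem_degLE`. -/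
lemma apply_sub_mem_degLE (V : PlaneVectorField) {h : MvPolynomial (Fin 2) ℂ}
    (hh : h ∈ degLE (V.degree - 1)) (ha : V.a - X 0 * h ∈ degLE (V.degree - 1))
    (hb : V.b - X 1 * h ∈ degLE (V.degree - 1)) {n : ℤ} {p : MvPolynomial (Fin 2) ℂ}
    (hp : p ∈ degLE n) :
    V.apply p - (n : MvPolynomial (Fin 2) ℂ) * h * p ∈ degLE (n + (V.degree - 2)) := by
  have e : n + ((V.degree : ℤ) - 2) = (V.degree - 1) + (n - 1) := by ring
  have key : V.apply p - (n : MvPolynomial (Fin 2) ℂ) * h * p =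
      h * (X 0 * pderiv 0 p + X 1 * pderiv 1 p - (n : MvPolynomial (Fin 2) ℂ) * p) +
      ((V.a - X 0 * h) * pderiv 0 p + (V.b - X 1 * h) * pderiv 1 p) := by
    rw [apply]; ring
  rw [e, key]
  exact add_mem (mul_mem_degLE hh (euler_mem_degLE hp))
    (add_mem (mul_mem_degLE ha (pderiv_mem_degLE hp 0)) (mul_mem_degLE hb (pderiv_mem_degLE hp 1)))

end PlaneVectorField

/-! ### Counting and enumerating monomials of degree at most l. -/

/-- The exponents of the monomials in two variables of degree at most `l`. -/
noncomputable def exponentsLE (l : ℕ) : Finset (Fin 2 →₀ ℕ) :=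
  ((Finset.range (l + 1)).biUnion Finset.HasAntidiagonal.antidiagonal).image
    fun p => Finsupp.single 0 p.1 + Finsupp.single 1 p.2

lemma mem_exponentsLE {l : ℕ} {s : Fin 2 →₀ ℕ} : s ∈ exponentsLE l ↔ s.degree ≤ l := by
  have hs : s.degree = s 0 + s 1 := by simp [Finsupp.degree_eq_sum, Fin.sum_univ_two]
  simp only [exponentsLE, Finset.mem_image, Finset.mem_biUnion, Finset.mem_range,
    Finset.HasAntidiagonal.mem_antidiagonal, hs]
  constructor
  · rintro ⟨p, ⟨n, hn, rfl⟩, rfl⟩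
    simp
    omega
  · intro h
    refine ⟨(s 0, s 1), ⟨_, by omega, rfl⟩, ?_⟩
    ext i
    fin_cases i <;> simp

lemma sum_exponentsLE (l : ℕ) (g : ℕ → ℤ) :
    ∑ s ∈ exponentsLE l, g s.degree = ∑ n ∈ Finset.range (l + 1), (n + 1) * g n := by
  rw [exponentsLE, Finset.sum_image, Finset.sum_biUnion]
  · refine Finset.sum_congr rfl fun n _ => ?_
    rw [Finset.sum_congr rfl (g := fun _ => g n)]
    · simp
    · intro p hp
      rw [Finset.HasAntidiagonal.mem_antidiagonal] at hp
      simp [← hp]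
  · intro m _ n _ hmn
    refine Finset.disjoint_left.2 fun p hp hq => hmn ?_
    rw [← Finset.HasAntidiagonal.mem_antidiagonal.1 hp, ← Finset.HasAntidiagonal.mem_antidiagonal.1 hq]
  · intro p _ q _ h
    have h0 := DFunLike.congr_fun h 0
    have h1 := DFunLike.congr_fun h 1
    simp at h0 h1
    exact Prod.ext h0 h1

lemma two_mul_card_exponentsLE (l : ℕ) :
    2 * ((exponentsLE l).card : ℤ) = (l + 1) * (l + 2) := by
  have h := sum_exponentsLE l fun _ => 1
  simp only [Finset.sum_const, nsmul_eq_mul, mul_one] at h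
  rw [h]
  clear h
  induction l with
  | zero => simp
  | succ l ih => rw [Finset.sum_range_succ, mul_add, ih]; push_cast; ring

lemma three_mul_sum_degree_exponentsLE (l : ℕ) :
    3 * ∑ s ∈ exponentsLE l, (s.degree : ℤ) = l * (l + 1) * (l + 2) := by
  rw [sum_exponentsLE l fun n => (n : ℤ)]
  induction l with
  | zero => simp
  | succ l ih => rw [Finset.sum_range_succ, mul_add, ih]; push_cast; ring

lemma two_mul_sum_fin_val (n : ℕ) : 2 * ∑ i : Fin n, (i : ℤ) = n * (n - 1) := by
  induction n with
  | zero => simp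
  | succ n ih => rw [Fin.sum_univ_castSucc, mul_add]; simp [ih]; ring

/-- The exponents of degree at most `l`, enumerated. -/
noncomputable def exponentEnum (l : ℕ) (j : Fin (exponentsLE l).card) : Fin 2 →₀ ℕ :=
  (exponentsLE l).equivFin.symm j

lemma exponentEnum_injective (l : ℕ) : Function.Injective (exponentEnum l) :=
  Subtype.val_injective.comp (Equiv.injective _)

lemma exists_exponentEnum {l : ℕ} {s : Fin 2 →₀ ℕ} (hs : s ∈ exponentsLE l) :
    ∃ j, exponentEnum l j = s :=
  ⟨(exponentsLE l).equivFin ⟨s, hs⟩, by simp [exponentEnum]⟩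

lemma degree_exponentEnum_le (l : ℕ) (j) : (exponentEnum l j).degree ≤ l :=
  mem_exponentsLE.1 (Subtype.property _)

lemma sum_exponentEnum {M : Type*} [AddCommMonoid M] (l : ℕ) (g : (Fin 2 →₀ ℕ) → M) :
    ∑ j, g (exponentEnum l j) = ∑ s ∈ exponentsLE l, g s := by
  rw [← Finset.sum_coe_sort (exponentsLE l)]
  exact Equiv.sum_comp (exponentsLE l).equivFin.symm fun s => g s

lemma eq_sum_monomial_exponentEnum {l : ℕ} {f : MvPolynomial (Fin 2) ℂ}
    (hf : f.totalDegree ≤ l) :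
    f = ∑ j, C (coeff (exponentEnum l j) f) * monomial (exponentEnum l j) 1 := by
  simp only [C_mul_monomial, mul_one]
  rw [sum_exponentEnum l fun s => monomial s (coeff s f)]
  nth_rewrite 1 [f.as_sum]
  refine Finset.sum_subset (fun s hs => mem_exponentsLE.2 ?_) fun s _ hs => ?_
  · exact (le_totalDegree hs : s.degree ≤ _).trans hf
  · rw [notMem_support_iff.1 hs, map_zero]

/-! ### The extactic polynomial: invariant factors and degree. -/

namespace PlaneVectorField

/-- The action of the vector field on polynomials, as a derivation. -/
noncomputable def toDerivation (V : PlaneVectorField) :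
    Derivation ℂ (MvPolynomial (Fin 2) ℂ) (MvPolynomial (Fin 2) ℂ) :=
  V.a • pderiv 0 + V.b • pderiv 1

lemma toDerivation_apply (V : PlaneVectorField) (p : MvPolynomial (Fin 2) ℂ) :
    V.toDerivation p = V.apply p := by
  simp [toDerivation, apply]

lemma apply_zero (V : PlaneVectorField) : V.apply 0 = 0 := by simp [apply]

lemma apply_mul (V : PlaneVectorField) (p q : MvPolynomial (Fin 2) ℂ) :
    V.apply (p * q) = p * V.apply q + q * V.apply p := by
  simp only [← toDerivation_apply, Derivation.leibniz, smul_eq_mul]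

lemma apply_sum (V : PlaneVectorField) {ι : Type*} (s : Finset ι)
    (p : ι → MvPolynomial (Fin 2) ℂ) : V.apply (∑ i ∈ s, p i) = ∑ i ∈ s, V.apply (p i) := by
  simp only [← toDerivation_apply, map_sum]

lemma apply_C (V : PlaneVectorField) (c : ℂ) : V.apply (C c) = 0 := by simp [apply]

lemma iterate_apply_sum (V : PlaneVectorField) {ι : Type*} (s : Finset ι) (c : ι → ℂ)
    (p : ι → MvPolynomial (Fin 2) ℂ) (i : ℕ) :
    V.apply^[i] (∑ j ∈ s, C (c j) * p j) = ∑ j ∈ s, C (c j) * V.apply^[i] (p j) := by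
  induction i with
  | zero => rfl
  | succ i ih =>
    simp only [Function.iterate_succ_apply', ih, apply_sum, apply_mul, apply_C, mul_zero, add_zero]

lemma dvd_iterate_apply (V : PlaneVectorField) {f : MvPolynomial (Fin 2) ℂ}
    (hf : f ∣ V.apply f) (i : ℕ) : f ∣ V.apply^[i] f := by
  induction i with
  | zero => rfl
  | succ i ih =>
    rw [Function.iterate_succ_apply']
    obtain ⟨q, hq⟩ := ih
    rw [hq, apply_mul]
    exact dvd_add (dvd_mul_right _ _) (hf.mul_left _)

/-- The matrix of iterated derivatives of the monomials of degree at most `l`. -/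
noncomputable def extacticMatrix (V : PlaneVectorField) (l : ℕ) :
    Matrix (Fin (exponentsLE l).card) (Fin (exponentsLE l).card) (MvPolynomial (Fin 2) ℂ) :=
  Matrix.of fun i j => V.apply^[i] (monomial (exponentEnum l j) 1)

/-- The `l`-th extactic polynomial of a vector field. -/
noncomputable def extactic (V : PlaneVectorField) (l : ℕ) : MvPolynomial (Fin 2) ℂ :=
  (V.extacticMatrix l).det

/-- The matrix sends the coefficient vector of `f` to the iterates V^i(f), all multiples of `f`.
Multiplying by the adjugate shows that `f` divides the determinant times each coefficient of `f`,
and one of these is a nonzero constant. -/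
lemma IsInvariantCurve.dvd_extactic {V : PlaneVectorField} {f : MvPolynomial (Fin 2) ℂ}
    (hf : V.IsInvariantCurve f) {l : ℕ} (hl : f.totalDegree ≤ l) : f ∣ V.extactic l := by
  choose K hK using V.dvd_iterate_apply hf.2
  have hmul : (V.extacticMatrix l).mulVec (fun j => C (coeff (exponentEnum l j) f)) =
      fun i : Fin _ => f * K i := by
    ext1 i
    rw [← hK i]
    conv_rhs => rw [eq_sum_monomial_exponentEnum hl, iterate_apply_sum]
    simp [Matrix.mulVec, dotProduct, extacticMatrix, mul_comm]
  have hf0 : f ≠ 0 := by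
    rintro rfl
    simpa using hf.1
  obtain ⟨s, hs⟩ := support_nonempty.2 hf0
  obtain ⟨j, rfl⟩ := exists_exponentEnum (mem_exponentsLE.2
    ((le_totalDegree hs : s.degree ≤ _).trans hl))
  have h := congrArg (fun v => (V.extacticMatrix l).adjugate.mulVec v j) hmul
  simp only [Matrix.mulVec_mulVec, Matrix.adjugate_mul, Matrix.smul_mulVec, Matrix.one_mulVec,
    Pi.smul_apply, smul_eq_mul] at h
  have hd : f ∣ V.extactic l * C (coeff (exponentEnum l j) f) := by
    rw [extactic, h, Matrix.mulVec, dotProduct]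
    exact Finset.dvd_sum fun i _ => (dvd_mul_right _ _).mul_left _
  exact (IsUnit.dvd_mul_right ((isUnit_iff_ne_zero.2 (mem_support_iff.1 hs)).map C)).1 hd

lemma extactic_mem_degLE (V : PlaneVectorField) (l : ℕ) :
    V.extactic l ∈ degLE (∑ i : Fin (exponentsLE l).card, (i : ℤ) * (V.degree - 1) +
      ∑ s ∈ exponentsLE l, (s.degree : ℤ)) := by
  rw [← sum_exponentEnum l fun s => (s.degree : ℤ)]
  refine det_mem_degLE fun i j => V.iterate_apply_mem_degLE ?_ i
  exact mem_degLE_of_totalDegree_le (totalDegree_monomial_le _ _)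

/-- A row-reduced form of the iterates of `V`, with entries of smaller degree. -/
noncomputable def radialIterate (V : PlaneVectorField) (h : MvPolynomial (Fin 2) ℂ) (l : ℕ)
    (p : MvPolynomial (Fin 2) ℂ) : ℕ → MvPolynomial (Fin 2) ℂ
  | 0 => p
  -- The factor uses the uniform degree bound i(d-2)+l rather than the degree of `p`, so that the
  -- same row operation applies to every column.
  | i + 1 => V.apply (radialIterate V h l p i) -
      ((i * (V.degree - 2) + l : ℤ) : MvPolynomial (Fin 2) ℂ) * h * radialIterate V h l p i

/-- Since `c` is independent of `p`, replacing the iterates by `radialIterate` amounts to left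
multiplication by a lower unitriangular matrix, which preserves the determinant. -/
lemma exists_radialIterate_eq_sum (V : PlaneVectorField) (h : MvPolynomial (Fin 2) ℂ) (l i : ℕ) :
    ∃ c : ℕ → MvPolynomial (Fin 2) ℂ, c i = 1 ∧ (∀ k, i < k → c k = 0) ∧
      ∀ p, V.radialIterate h l p i = ∑ k ∈ Finset.range (i + 1), c k * V.apply^[k] p := by
  induction i with
  | zero => exact ⟨fun k => if k = 0 then 1 else 0, by simp, fun k hk => if_neg hk.ne',
      fun p => by simp [radialIterate]⟩
  | succ i ih =>
    obtain ⟨c, h1, h0, hc⟩ := ih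
    set t : MvPolynomial (Fin 2) ℂ :=
      ((i * (V.degree - 2) + l : ℤ) : MvPolynomial (Fin 2) ℂ) * h with ht
    refine ⟨fun k => V.apply (c k) - t * c k + (if k = 0 then 0 else c (k - 1)), ?_, fun k hk => ?_, fun p => ?_⟩
    · simp [h0, apply_zero, h1]
    · obtain ⟨k, rfl⟩ : ∃ m, k = m + 1 := ⟨k - 1, by omega⟩
      simp [h0 (k + 1) (by omega), h0 k (by omega), apply_zero]
    · simp only [add_mul, Finset.sum_add_distrib]
      rw [radialIterate, ← ht, hc, Finset.sum_range_succ _ (i + 1), h0 (i + 1) (by omega),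
        Finset.sum_range_succ' (fun k => (if k = 0 then 0 else c (k - 1)) * V.apply^[k] p)]
      simp only [apply_zero, mul_zero, sub_zero, zero_mul, add_zero, if_true, Nat.add_sub_cancel,
        Nat.succ_ne_zero, if_false]
      rw [apply_sum, Finset.mul_sum, ← Finset.sum_sub_distrib, ← Finset.sum_add_distrib]
      refine Finset.sum_congr rfl fun k _ => ?_
      rw [apply_mul, Function.iterate_succ_apply']
      ring

lemma radialIterate_mem_degLE (V : PlaneVectorField) {h : MvPolynomial (Fin 2) ℂ}
    (hh : h ∈ degLE (V.degree - 1)) (ha : V.a - X 0 * h ∈ degLE (V.degree - 1))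
    (hb : V.b - X 1 * h ∈ degLE (V.degree - 1)) {l : ℕ} {p : MvPolynomial (Fin 2) ℂ}
    (hp : p.totalDegree ≤ l) (i : ℕ) :
    V.radialIterate h l p i ∈ degLE (i * (V.degree - 2) + l) := by
  induction i with
  | zero => simpa [radialIterate] using mem_degLE_of_totalDegree_le hp
  | succ i ih =>
    rw [radialIterate]
    convert V.apply_sub_mem_degLE hh ha hb ih using 2
    push_cast
    ring

lemma extactic_mem_degLE_of_not_lineAtInfinityInvariant (V : PlaneVectorField)
    (hV : ¬ V.LineAtInfinityInvariant) (l : ℕ) :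
    V.extactic l ∈ degLE (∑ i : Fin (exponentsLE l).card, ((i : ℤ) * (V.degree - 2) + l)) := by
  obtain ⟨h, hh, ha, hb⟩ := V.exists_radial_part hV
  choose c hc1 hc0 hc using V.exists_radialIterate_eq_sum h l
  have hdet : V.extactic l = (Matrix.of fun i j : Fin (exponentsLE l).card =>
      V.radialIterate h l (monomial (exponentEnum l j) 1) i).det := by
    have hL : (Matrix.of fun i k : Fin (exponentsLE l).card => c i k).det = 1 := by
      rw [Matrix.det_of_isLowerTriangular]
      · simp [hc1]
      · intro i k hik
        exact hc0 _ _ hik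
    rw [extactic, ← one_mul (V.extacticMatrix l).det, ← hL, ← Matrix.det_mul]
    congr 1
    ext1 i j
    simp only [Matrix.mul_apply, Matrix.of_apply, extacticMatrix]
    rw [hc, Fin.sum_univ_eq_sum_range
      (fun k => c i k * V.apply^[k] (monomial (exponentEnum l j) 1))]
    refine (Finset.sum_subset (by simp) fun k _ hk => ?_).symm
    rw [hc0 _ _ (by simpa using hk), zero_mul]
  rw [hdet]
  have := det_mem_degLE (c := fun _ => 0) (r := fun i => (i : ℤ) * (V.degree - 2) + l)
    (A := (Matrix.of fun i j : Fin (exponentsLE l).card =>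
      V.radialIterate h l (monomial (exponentEnum l j) 1) i)) fun i j => by
    simpa using V.radialIterate_mem_degLE hh ha hb
      ((totalDegree_monomial_le _ _).trans (degree_exponentEnum_le l j)) i
  simpa using this

end PlaneVectorField

/-! ### Vanishing of the extactic polynomial gives a first integral. -/

namespace PlaneVectorField

/-- If the extactic polynomial vanishes, the iterated derivatives of the monomials of degree at most
`l` satisfy a nontrivial linear relation whose polynomial coefficients do not depend on the order. -/
lemma exists_relation_of_extactic_eq_zero (V : PlaneVectorField) {l : ℕ}
    (h : V.extactic l = 0) :
    ∃ c : Fin (exponentsLE l).card → MvPolynomial (Fin 2) ℂ, c ≠ 0 ∧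
      ∀ i : ℕ, ∑ j, c j * V.apply^[i] (monomial (exponentEnum l j) 1) = 0 := by
  classical
  obtain ⟨c, hc0, hc⟩ := Matrix.exists_mulVec_eq_zero_iff.2 h
  -- The right kernel vector `c` gives the relation only for orders below N. The left kernel vector
  -- `w` is a differential equation satisfied by all the monomials; its order `r` is the last index
  -- with `w r ≠ 0`.
  obtain ⟨w, hw0, hw⟩ := Matrix.exists_vecMul_eq_zero_iff.2 h
  have hne : (Finset.univ.filter fun k => w k ≠ 0).Nonempty := by
    obtain ⟨k, hk⟩ := Function.ne_iff.1 hw0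
    exact ⟨k, by simpa using hk⟩
  obtain ⟨r, hr, hmax⟩ : ∃ r, w r ≠ 0 ∧ ∀ k, w k ≠ 0 → k ≤ r :=
    ⟨_, (Finset.mem_filter.1 (Finset.max'_mem _ hne)).2,
      fun k hk => Finset.le_max' _ k (by simpa using hk)⟩
  -- Applying V to the equation n times raises its order to r + n and keeps its nonzero leading
  -- coefficient. Each higher iterate is thus governed by the lower ones, which carries the relation
  -- `c` to every order.
  have hrel : ∀ n : ℕ, ∃ u : ℕ → MvPolynomial (Fin 2) ℂ, u (r + n) ≠ 0 ∧
      (∀ k, r + n < k → u k = 0) ∧ ∀ j, ∑ k ∈ Finset.range (r + n + 1),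
        u k * V.apply^[k] (monomial (exponentEnum l j) 1) = 0 := by
    intro n
    induction n with
    | zero =>
      have hu : ∀ k : ℕ, (r : ℕ) + 0 < k → (if hk : k < (exponentsLE l).card then w ⟨k, hk⟩ else 0) = 0 := by
        intro k hk
        split_ifs with hk'
        · by_contra hne
          have h2 := hmax _ hne
          rw [Fin.le_def] at h2
          simp at h2 hk
          omega
        · rfl
      refine ⟨fun k => if hk : k < (exponentsLE l).card then w ⟨k, hk⟩ else 0, ?_, hu, fun j => ?_⟩
      · simpa using hr
      · have hj := congrFun hw j
        simp only [Matrix.vecMul, dotProduct, extacticMatrix, Matrix.of_apply, Pi.zero_apply] at hj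
        refine Eq.trans ?_ hj
        rw [Finset.sum_subset (s₂ := Finset.range (exponentsLE l).card),
          ← Fin.sum_univ_eq_sum_range]
        · simp
        · intro k hk
          simp only [Finset.mem_range] at hk ⊢
          omega
        · intro k _ hk
          exact mul_eq_zero_of_left (hu k (by simpa using hk)) _
    | succ n ih =>
      obtain ⟨u, hu, hu0, hs⟩ := ih
      refine ⟨fun k => V.apply (u k) + (if k = 0 then 0 else u (k - 1)), ?_, fun k hk => ?_,
        fun j => ?_⟩
      · have h1 : u (r + n + 1) = 0 := hu0 _ (by omega)
        simpa [h1, apply_zero, ← add_assoc] using hu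
      · simp [hu0 k (by omega), hu0 (k - 1) (by omega), apply_zero]
      · have hd := congrArg V.apply (hs j)
        rw [apply_zero, apply_sum] at hd
        simp only [add_mul, Finset.sum_add_distrib, ← add_assoc]
        rw [Finset.sum_range_succ _ (r + n + 1), hu0 (r + n + 1) (by omega),
          Finset.sum_range_succ' (fun k => (if k = 0 then 0 else u (k - 1)) * V.apply^[k] _)]
        simp only [apply_zero, zero_mul, add_zero, if_true, Nat.add_sub_cancel,
          Nat.succ_ne_zero, if_false]
        rw [← hd, ← Finset.sum_add_distrib]
        refine Finset.sum_congr rfl fun k _ => ?_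
        rw [apply_mul, Function.iterate_succ_apply']
        ring
  refine ⟨c, hc0, fun i => ?_⟩
  induction i using Nat.strong_induction_on with
  | _ i ih =>
    by_cases hi : i < (exponentsLE l).card
    · have := congrFun hc ⟨i, hi⟩
      simpa [Matrix.mulVec, dotProduct, extacticMatrix, mul_comm] using this
    · obtain ⟨u, hu, -, hs⟩ := hrel (i - r)
      rw [show (r : ℕ) + (i - r) = i by omega] at hu hs
      have key : ∑ k ∈ Finset.range (i + 1),
          u k * ∑ j, c j * V.apply^[k] (monomial (exponentEnum l j) 1) = 0 := by
        simp only [Finset.mul_sum]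
        rw [Finset.sum_comm]
        refine Finset.sum_eq_zero fun j _ => ?_
        rw [← mul_zero (c j), ← hs j, Finset.mul_sum]
        exact Finset.sum_congr rfl fun k _ => mul_left_comm _ _ _
      rw [Finset.sum_range_succ, Finset.sum_eq_zero, zero_add] at key
      · exact (mul_eq_zero.1 key).resolve_left hu
      · intro k hk
        rw [ih k (Finset.mem_range.1 hk), mul_zero]

/-- Descent on the number of nonzero `c j`. The vector `c'` collects the numerators of V(c_j /
c_{j₀}); it satisfies the same relations and has smaller support. If it vanishes, every ratio c_j /
c_{j₀} is annihilated by V. One of them is then a nonconstant first integral, as otherwise the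
relation of order 0 would be a linear dependence over ℂ between distinct monomials. -/
lemma hasRationalFirstIntegral_of_relation (V : PlaneVectorField) {l : ℕ}
    (c : Fin (exponentsLE l).card → MvPolynomial (Fin 2) ℂ) (hc0 : c ≠ 0)
    (hc : ∀ i : ℕ, ∑ j, c j * V.apply^[i] (monomial (exponentEnum l j) 1) = 0) :
    V.HasRationalFirstIntegral := by
  classical
  induction hn : (Finset.univ.filter fun j => c j ≠ 0).card using Nat.strong_induction_on
    generalizing c with
  | _ n ih =>
    obtain ⟨j₀, hj₀⟩ := Function.ne_iff.1 hc0
    rw [Pi.zero_apply] at hj₀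
    let c' : Fin (exponentsLE l).card → MvPolynomial (Fin 2) ℂ :=
      fun j => c j₀ * V.apply (c j) - c j * V.apply (c j₀)
    by_cases hc' : c' = 0
    · by_contra hno
      have hα : ∀ j, ∃ α : ℂ, c j = C α * c j₀ := by
        intro j
        by_contra! hj
        exact hno ⟨c j, c j₀, hj₀, hj, congrFun hc' j⟩
      choose α hα using hα
      have h0 := hc 0
      have h1 : c j₀ * ∑ j, C (α j) * monomial (exponentEnum l j) 1 = 0 := by
        rw [← h0, Finset.mul_sum]
        refine Finset.sum_congr rfl fun j _ => ?_
        rw [hα j, Function.iterate_zero, id]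
        ring
      have h2 := congrArg (coeff (exponentEnum l j₀)) ((mul_eq_zero.1 h1).resolve_left hj₀)
      simp only [coeff_sum, coeff_C_mul, coeff_monomial, (exponentEnum_injective l).eq_iff,
        mul_ite, mul_one, mul_zero, Finset.sum_ite_eq', Finset.mem_univ,
        if_true, coeff_zero] at h2
      exact hj₀ (by rw [hα j₀, h2]; simp)
    · refine ih _ ?_ c' hc' (fun i => ?_) rfl
      · rw [← hn]
        refine Finset.card_lt_card ((Finset.ssubset_iff_of_subset fun j hj => ?_).2
          ⟨j₀, by simpa using hj₀, by simp [c']⟩)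
        simp only [Finset.mem_filter, Finset.mem_univ, true_and] at hj ⊢
        intro h
        simp [c', h, apply_zero] at hj
      -- V of the relation of order i, minus the relation of order i + 1, leaves Σ V(c_j) V^i(m_j) =
      -- 0.
      · have hd := congrArg V.apply (hc i)
        rw [apply_zero, apply_sum] at hd
        simp only [apply_mul, Finset.sum_add_distrib] at hd
        have h1 := hc (i + 1)
        simp only [Function.iterate_succ_apply'] at h1
        rw [h1, zero_add] at hd
        calc ∑ j, c' j * V.apply^[i] (monomial (exponentEnum l j) 1)
            = c j₀ * ∑ j, V.apply^[i] (monomial (exponentEnum l j) 1) * V.apply (c j) -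
              V.apply (c j₀) * ∑ j, c j * V.apply^[i] (monomial (exponentEnum l j) 1) := by
              rw [Finset.mul_sum, Finset.mul_sum, ← Finset.sum_sub_distrib]
              refine Finset.sum_congr rfl fun j _ => ?_
              simp only [c']
              ring
          _ = 0 := by rw [hd, hc i]; simp

lemma hasRationalFirstIntegral_of_extactic_eq_zero (V : PlaneVectorField) {l : ℕ}
    (h : V.extactic l = 0) : V.HasRationalFirstIntegral :=
  let ⟨c, hc0, hc⟩ := V.exists_relation_of_extactic_eq_zero h
  V.hasRationalFirstIntegral_of_relation c hc0 hc

end PlaneVectorField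

/-! ### Coefficientwise limits and divisibility. -/

section CoeffTendsto

variable {α : Type*} {u : Filter α}

/-- Coefficientwise convergence of polynomials along a filter. -/
def CoeffTendsto (u : Filter α) (F : α → MvPolynomial (Fin 2) ℂ)
    (f : MvPolynomial (Fin 2) ℂ) : Prop :=
  ∀ s : Fin 2 →₀ ℕ, Tendsto (fun k => coeff s (F k)) u (𝓝 (coeff s f))

namespace CoeffTendsto

variable {F G : α → MvPolynomial (Fin 2) ℂ} {f g : MvPolynomial (Fin 2) ℂ}

lemma const (f : MvPolynomial (Fin 2) ℂ) : CoeffTendsto u (fun _ => f) f :=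
  fun _ => tendsto_const_nhds

lemma unique [u.NeBot] (hf : CoeffTendsto u F f) (hg : CoeffTendsto u F g) : f = g :=
  MvPolynomial.ext _ _ fun s => tendsto_nhds_unique (hf s) (hg s)

lemma add (hF : CoeffTendsto u F f) (hG : CoeffTendsto u G g) :
    CoeffTendsto u (fun k => F k + G k) (f + g) := fun s => by
  simpa only [coeff_add] using (hF s).add (hG s)

lemma mul (hF : CoeffTendsto u F f) (hG : CoeffTendsto u G g) :
    CoeffTendsto u (fun k => F k * G k) (f * g) := fun s => by
  classical
  simp only [coeff_mul]
  exact tendsto_finsetSum _ fun x _ => (hF x.1).mul (hG x.2)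

lemma neg (hF : CoeffTendsto u F f) : CoeffTendsto u (fun k => - F k) (-f) := fun s => by
  simpa only [coeff_neg] using (hF s).neg

lemma pderiv (hF : CoeffTendsto u F f) (i : Fin 2) :
    CoeffTendsto u (fun k => pderiv i (F k)) (pderiv i f) := fun s => by
  simpa only [coeff_pderiv] using (hF _).mul_const _

lemma sum {ι : Type*} (s : Finset ι) {F : ι → α → MvPolynomial (Fin 2) ℂ}
    {f : ι → MvPolynomial (Fin 2) ℂ} (h : ∀ i ∈ s, CoeffTendsto u (F i) (f i)) :
    CoeffTendsto u (fun k => ∑ i ∈ s, F i k) (∑ i ∈ s, f i) := fun x => by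
  simpa only [coeff_sum] using tendsto_finsetSum _ fun i hi => h i hi x

lemma prod {ι : Type*} (s : Finset ι) {F : ι → α → MvPolynomial (Fin 2) ℂ}
    {f : ι → MvPolynomial (Fin 2) ℂ} (h : ∀ i ∈ s, CoeffTendsto u (F i) (f i)) :
    CoeffTendsto u (fun k => ∏ i ∈ s, F i k) (∏ i ∈ s, f i) := by
  classical
  induction s using Finset.induction_on with
  | empty => simpa using const 1
  | insert i s hi ih =>
    simp only [Finset.prod_insert hi]
    exact (h i (by simp)).mul (ih fun j hj => h j (by simp [hj]))

lemma det {ι : Type*} [Fintype ι] [DecidableEq ι]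
    {A : α → Matrix ι ι (MvPolynomial (Fin 2) ℂ)} {B : Matrix ι ι (MvPolynomial (Fin 2) ℂ)}
    (h : ∀ i j, CoeffTendsto u (fun k => A k i j) (B i j)) :
    CoeffTendsto u (fun k => (A k).det) B.det := by
  simp only [Matrix.det_apply]
  refine sum _ fun σ _ => ?_
  have := prod Finset.univ fun i (_ : i ∈ Finset.univ) => h (σ i) i
  rcases Int.units_eq_one_or (Equiv.Perm.sign σ) with h | h <;> rw [h]
  · simpa using this
  · simpa using this.neg

lemma apply {W : α → PlaneVectorField} {V : PlaneVectorField}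
    (ha : CoeffTendsto u (fun k => (W k).a) V.a) (hb : CoeffTendsto u (fun k => (W k).b) V.b)
    (hF : CoeffTendsto u F f) : CoeffTendsto u (fun k => (W k).apply (F k)) (V.apply f) :=
  (ha.mul (hF.pderiv 0)).add (hb.mul (hF.pderiv 1))

/-- Divisibility passes to coefficientwise limits, as long as the quotients have bounded support
and the limit of the divisors is nonzero. -/
lemma dvd_of_eq_mul {u : Ultrafilter α} {H : α → MvPolynomial (Fin 2) ℂ}
    {h : MvPolynomial (Fin 2) ℂ} (hF : CoeffTendsto u F f) (hH : CoeffTendsto u H h) (hf : f ≠ 0)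
    {Q : α → MvPolynomial (Fin 2) ℂ} (hQ : ∀ k, H k = F k * Q k) (S : Finset (Fin 2 →₀ ℕ))
    (hS : ∀ k, (Q k).support ⊆ S) : f ∣ h := by
  classical
  let n : α → ℝ := fun k => ∑ s ∈ S, ‖coeff s (Q k)‖
  have hn : ∀ k, 0 ≤ n k := fun k => Finset.sum_nonneg fun _ _ => norm_nonneg _
  -- The quotients may be unbounded, so the pair (1, `Q k`) is scaled to total norm 1. By
  -- compactness it converges along the ultrafilter to a pair (`τ`, `q`) of total norm 1 with τ h =
  -- f q.
  let t : α → ℝ := fun k => (1 + n k)⁻¹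
  have ht0 : ∀ k, 0 ≤ t k := fun k => inv_nonneg.2 (by linarith [hn k])
  have htot : ∀ k, t k + ∑ s ∈ S, ‖(t k : ℂ) * coeff s (Q k)‖ = 1 := fun k => by
    have h1 : (1 + n k) ≠ 0 := by linarith [hn k]
    simp only [norm_mul, ← Finset.mul_sum, Complex.norm_real, Real.norm_eq_abs,
      abs_of_nonneg (ht0 k)]
    change t k + t k * n k = 1
    rw [show t k = (1 + n k)⁻¹ from rfl]
    field_simp
  have ht1 : ∀ k, t k ∈ Set.Icc (0 : ℝ) 1 := fun k => ⟨ht0 k, by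
    linarith [htot k, Finset.sum_nonneg fun s (_ : s ∈ S) => norm_nonneg ((t k : ℂ) * coeff s (Q k))]⟩
  have hq1 : ∀ s ∈ S, ∀ k, (t k : ℂ) * coeff s (Q k) ∈ Metric.closedBall (0 : ℂ) 1 :=
    fun s hs k => by
      rw [mem_closedBall_zero_iff]
      have := Finset.single_le_sum (f := fun s => ‖(t k : ℂ) * coeff s (Q k)‖)
        (fun _ _ => norm_nonneg _) hs
      linarith [htot k, ht0 k]
  obtain ⟨τ, -, hτ⟩ := isCompact_Icc.ultrafilter_le_nhds (u.map t)
    (tendsto_principal.2 (Eventually.of_forall ht1))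
  replace hτ : Tendsto t u (𝓝 τ) := hτ
  have hlim : ∀ s, ∃ z : ℂ, s ∈ S → Tendsto (fun k => (t k : ℂ) * coeff s (Q k)) u (𝓝 z) := by
    intro s
    by_cases hs : s ∈ S
    · obtain ⟨z, -, hz⟩ := (isCompact_closedBall (0 : ℂ) 1).ultrafilter_le_nhds
        (u.map fun k => (t k : ℂ) * coeff s (Q k))
        (tendsto_principal.2 (Eventually.of_forall (hq1 s hs)))
      exact ⟨z, fun _ => hz⟩
    · exact ⟨0, fun h => absurd h hs⟩
  choose z hz using hlim
  let q : MvPolynomial (Fin 2) ℂ := ∑ s ∈ S, monomial s (z s)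
  have hcq : ∀ s, coeff s q = if s ∈ S then z s else 0 := fun s => by
    simp [q, coeff_sum, coeff_monomial]
  have hqt : CoeffTendsto u (fun k => C (t k : ℂ) * Q k) q := fun s => by
    simp only [coeff_C_mul, hcq]
    split_ifs with hs
    · exact hz s hs
    · have : ∀ k, coeff s (Q k) = 0 := fun k => notMem_support_iff.1 fun h => hs (hS k h)
      simp [this]
  have hct : CoeffTendsto u (fun k => C (t k : ℂ)) (C (τ : ℂ)) := fun s => by
    simp only [coeff_C]
    split_ifs
    · exact (Complex.continuous_ofReal.tendsto _).comp hτ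
    · exact tendsto_const_nhds
  have heq : C (τ : ℂ) * h = f * q := by
    refine (hct.mul hH).unique (F := fun k => C (t k : ℂ) * H k) ?_
    have := hF.mul hqt
    simpa only [hQ, mul_left_comm] using this
  have hsum : τ + ∑ s ∈ S, ‖z s‖ = 1 := by
    have h1 : Tendsto (fun k => t k + ∑ s ∈ S, ‖(t k : ℂ) * coeff s (Q k)‖) u
        (𝓝 (τ + ∑ s ∈ S, ‖z s‖)) :=
      hτ.add (tendsto_finsetSum _ fun s hs => (hz s hs).norm)
    simp only [htot] at h1
    exact (tendsto_nhds_unique h1 tendsto_const_nhds)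
  -- If `τ` were 0, then f q = 0 would force q = 0, against total norm 1.
  have hτ0 : τ ≠ 0 := by
    rintro rfl
    have hq0 : q = 0 := by
      have : f * q = 0 := by rw [← heq]; simp
      exact (mul_eq_zero.1 this).resolve_left hf
    have : ∑ s ∈ S, ‖z s‖ = 0 := Finset.sum_eq_zero fun s hs => by
      have := hcq s
      rw [hq0, if_pos hs] at this
      simp [← this]
    linarith
  have hu : IsUnit (C (τ : ℂ) : MvPolynomial (Fin 2) ℂ) :=
    (isUnit_iff_ne_zero.2 (Complex.ofReal_ne_zero.2 hτ0)).map C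
  exact (hu.dvd_mul_left).1 ⟨q, heq⟩

end CoeffTendsto

end CoeffTendsto

/-! ### Geometric multiplicities against the degree of the extactic polynomial. -/

lemma not_isUnit_of_totalDegree_pos {f : MvPolynomial (Fin 2) ℂ} (hf : 0 < f.totalDegree) :
    ¬ IsUnit f := fun h => by
  rw [isUnit_iff_totalDegree_of_isReduced] at h
  exact hf.ne' h.2

lemma ne_zero_of_totalDegree_pos {f : MvPolynomial (Fin 2) ℂ} (hf : 0 < f.totalDegree) :
    f ≠ 0 := by
  rintro rfl
  simp at hf

lemma totalDegree_pow_of_ne_zero {f : MvPolynomial (Fin 2) ℂ} (hf : f ≠ 0) (n : ℕ) :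
    (f ^ n).totalDegree = f.totalDegree * n := by
  induction n with
  | zero => simp
  | succ n ih => rw [pow_succ, totalDegree_mul_of_isDomain (pow_ne_zero _ hf) hf, ih]; ring

lemma totalDegree_prod_of_ne_zero {ι : Type*} (s : Finset ι) {f : ι → MvPolynomial (Fin 2) ℂ}
    (hf : ∀ i ∈ s, f i ≠ 0) : (∏ i ∈ s, f i).totalDegree = ∑ i ∈ s, (f i).totalDegree := by
  classical
  induction s using Finset.induction_on with
  | empty => simp
  | insert i s hi ih =>
    have hs : ∀ j ∈ s, f j ≠ 0 := fun j hj => hf j (by simp [hj])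
    rw [Finset.prod_insert hi, Finset.sum_insert hi, totalDegree_mul_of_isDomain
      (hf i (by simp)) (Finset.prod_ne_zero_iff.2 hs), ih hs]

namespace PlaneVectorField

lemma coeffTendsto_extactic {α : Type*} {u : Filter α} {W : α → PlaneVectorField}
    {V : PlaneVectorField} (ha : CoeffTendsto u (fun k => (W k).a) V.a)
    (hb : CoeffTendsto u (fun k => (W k).b) V.b) (l : ℕ) :
    CoeffTendsto u (fun k => (W k).extactic l) (V.extactic l) := by
  refine CoeffTendsto.det fun i j => ?_
  simp only [extacticMatrix, Matrix.of_apply]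
  induction (i : ℕ) with
  | zero => exact CoeffTendsto.const _
  | succ i ih =>
    simp only [Function.iterate_succ_apply']
    exact CoeffTendsto.apply ha hb ih

lemma HasGeomMultiplicity.pow_dvd_extactic {V : PlaneVectorField} {f : MvPolynomial (Fin 2) ℂ}
    (hf : f ≠ 0) {l m : ℕ} (h : V.HasGeomMultiplicity f l m) : f ^ m ∣ V.extactic l := by
  obtain ⟨W, g, hdeg, ha, hb, hg, hprime, hlim⟩ := h
  have hdvd : ∀ k, ∏ i, g k i ∣ (W k).extactic l := fun k =>
    Finset.prod_dvd_of_isRelPrime (fun i _ j _ hij => hprime k hij)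
      fun i _ => (hg k i).1.dvd_extactic (hg k i).2
  have hg0 : ∀ k i, g k i ≠ 0 := fun k i => ne_zero_of_totalDegree_pos (hg k i).1.1
  choose Q hQ using hdvd
  -- All `W k` have the degree of `V`, so one bound on the extactic degrees serves for every k.
  obtain ⟨N, hN⟩ : ∃ N : ℕ, ∀ k, (Q k).totalDegree ≤ N := by
    refine ⟨(∑ i : Fin (exponentsLE l).card, (i : ℤ) * (V.degree - 1) +
      ∑ s ∈ exponentsLE l, (s.degree : ℤ)).toNat, fun k => ?_⟩
    by_cases hE : (W k).extactic l = 0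
    · have : Q k = 0 := by
        exact (mul_eq_zero.1 ((hQ k).symm.trans hE)).resolve_left
          (Finset.prod_ne_zero_iff.2 fun i _ => hg0 k i)
      simp [this]
    · have h1 := totalDegree_le_of_mem_degLE ((W k).extactic_mem_degLE l) hE
      have h2 := totalDegree_le_of_dvd_of_isDomain (Dvd.intro_left _ (hQ k).symm) hE
      rw [hdeg] at h1
      omega
  let u : Ultrafilter ℕ := Ultrafilter.of atTop
  have hu : (u : Filter ℕ) ≤ atTop := Ultrafilter.of_le _
  have hF : CoeffTendsto u (fun k => ∏ i, g k i) (f ^ m) := by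
    have := CoeffTendsto.prod (u := (u : Filter ℕ)) (Finset.univ : Finset (Fin m))
      (F := fun i k => g k i) (f := fun _ => f) fun i _ s => (hlim i s).mono_left hu
    simpa using this
  exact hF.dvd_of_eq_mul
    (coeffTendsto_extactic (fun s => (ha s).mono_left hu) (fun s => (hb s).mono_left hu) l)
    (pow_ne_zero _ hf) hQ (exponentsLE N) fun k s hs =>
      mem_exponentsLE.2 ((le_totalDegree hs : s.degree ≤ _).trans (hN k))

lemma geomMultiplicity_le_multiplicity {V : PlaneVectorField} {f : MvPolynomial (Fin 2) ℂ}
    (hf : 0 < f.totalDegree) {l : ℕ} (hE : V.extactic l ≠ 0) :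
    V.geomMultiplicity l f ≤ (multiplicity f (V.extactic l) : ℕ) := by
  rw [← (FiniteMultiplicity.of_not_isUnit
    (not_isUnit_of_totalDegree_pos hf) hE).emultiplicity_eq_multiplicity]
  exact iSup₂_le fun m hm =>
    pow_dvd_iff_le_emultiplicity.1 (hm.pow_dvd_extactic (ne_zero_of_totalDegree_pos hf))

lemma sum_geomMultiplicity_le {V : PlaneVectorField} {p : ℕ}
    {f : Fin p → MvPolynomial (Fin 2) ℂ} (hf : ∀ j, 0 < (f j).totalDegree)
    (hdist : Pairwise fun i j => IsRelPrime (f i) (f j)) {l : ℕ} (hE : V.extactic l ≠ 0) :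
    ∑ j, ((f j).totalDegree : ℕ∞) * V.geomMultiplicity l (f j) ≤
      ((V.extactic l).totalDegree : ℕ∞) := by
  have hf0 : ∀ j, f j ≠ 0 := fun j => ne_zero_of_totalDegree_pos (hf j)
  have hdvd : ∏ j, f j ^ multiplicity (f j) (V.extactic l) ∣ V.extactic l :=
    Finset.prod_dvd_of_isRelPrime (fun i _ j _ hij => (hdist hij).pow)
      fun j _ => pow_multiplicity_dvd _ _
  have h1 := totalDegree_le_of_dvd_of_isDomain hdvd hE
  rw [totalDegree_prod_of_ne_zero _ fun j _ => pow_ne_zero _ (hf0 j)] at h1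
  simp only [totalDegree_pow_of_ne_zero (hf0 _)] at h1
  calc ∑ j, ((f j).totalDegree : ℕ∞) * V.geomMultiplicity l (f j)
      ≤ ∑ j, ((f j).totalDegree : ℕ∞) * (multiplicity (f j) (V.extactic l) : ℕ) :=
        Finset.sum_le_sum fun j _ =>
          mul_le_mul_right (geomMultiplicity_le_multiplicity (hf j) hE) _
    _ ≤ ((V.extactic l).totalDegree : ℕ∞) := by exact_mod_cast h1

lemma totalDegree_extactic_le_nBound {V : PlaneVectorField} {l : ℕ} (hl : 0 < l)
    (hE : V.extactic l ≠ 0) : ((V.extactic l).totalDegree : ℝ) ≤ V.nBound l ∧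
      (2 ≤ l → V.LineAtInfinityInvariant → ((V.extactic l).totalDegree : ℝ) < V.nBound l) := by
  have hM : 2 * ((exponentsLE l).card : ℝ) = (l + 1) * (l + 2) := by
    exact_mod_cast two_mul_card_exponentsLE l
  have hI : 2 * ((∑ i : Fin (exponentsLE l).card, (i : ℤ) : ℤ) : ℝ) =
      (exponentsLE l).card * ((exponentsLE l).card - 1) := by
    exact_mod_cast two_mul_sum_fin_val (exponentsLE l).card
  have hS : 3 * ((∑ s ∈ exponentsLE l, (s.degree : ℤ) : ℤ) : ℝ) = l * (l + 1) * (l + 2) := by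
    exact_mod_cast three_mul_sum_degree_exponentsLE l
  have hM' : ((exponentsLE l).card : ℝ) = (l + 1) * (l + 2) / 2 := by linarith
  rw [hM'] at hI
  set I : ℤ := ∑ i : Fin (exponentsLE l).card, (i : ℤ) with hIdef
  set S : ℤ := ∑ s ∈ exponentsLE l, (s.degree : ℤ) with hSdef
  have hI' : (I : ℝ) = ((l : ℝ) ^ 4 + 6 * l ^ 3 + 11 * l ^ 2 + 6 * l) / 8 := by linarith
  have hS' : (S : ℝ) = l * (l + 1) * (l + 2) / 3 := by linarith
  have hl1 : (1 : ℝ) ≤ l := by exact_mod_cast hl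
  by_cases hV : V.LineAtInfinityInvariant
  · have h := totalDegree_le_of_mem_degLE (V.extactic_mem_degLE l) hE
    rw [← Finset.sum_mul, ← hIdef, ← hSdef] at h
    clear_value I S
    have h' : ((V.extactic l).totalDegree : ℝ) ≤ I * (V.degree - 1) + S := by exact_mod_cast h
    -- This gap vanishes at l = 1 and is positive for l ≥ 2, which is why equality with n_l then
    -- suffices. In the non-invariant case the degree bound equals n_l exactly.
    have hdiff : V.nBound l - (I * (V.degree - 1) + S) =
        (l : ℝ) * (l - 1) * (l + 4) / 6 := by
      rw [nBound, if_pos hV, hI', hS']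
      ring
    refine ⟨?_, fun hl2 _ => ?_⟩
    · have : 0 ≤ (l : ℝ) * (l - 1) * (l + 4) / 6 := by
        have : 0 ≤ (l : ℝ) - 1 := by linarith
        positivity
      linarith
    · have hl2' : (2 : ℝ) ≤ l := by exact_mod_cast hl2
      have : 0 < (l : ℝ) * (l - 1) * (l + 4) / 6 := by
        have : 0 < (l : ℝ) - 1 := by linarith
        positivity
      linarith
  · have h := totalDegree_le_of_mem_degLE
      (V.extactic_mem_degLE_of_not_lineAtInfinityInvariant hV l) hE
    rw [Finset.sum_add_distrib, ← Finset.sum_mul, ← hIdef] at h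
    clear_value I S
    simp only [Finset.sum_const, Finset.card_univ, Fintype.card_fin, nsmul_eq_mul] at h
    have h' : ((V.extactic l).totalDegree : ℝ) ≤
        I * (V.degree - 2) + (exponentsLE l).card * l := by exact_mod_cast h
    refine ⟨h'.trans (le_of_eq ?_), fun _ h => absurd h hV⟩
    rw [nBound, if_neg hV, hI', hM']
    ring

end PlaneVectorField

theorem mainTheorem2 (V : PlaneVectorField) (p : ℕ) (f : Fin p → MvPolynomial (Fin 2) ℂ)
    (hf : ∀ j, V.IsInvariantCurve (f j))
    (hdist : Pairwise fun i j => IsRelPrime (f i) (f j))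
    (l : ℕ) (hl : 0 < l)
    (hsum :
      ((V.nBound l : ℝ) : EReal) <
          (((∑ j, ((f j).totalDegree : ℕ∞) * V.geomMultiplicity l (f j) : ℕ∞) : ℝ≥0∞) : EReal) ∨
        (2 ≤ l ∧ V.LineAtInfinityInvariant ∧
          ((V.nBound l : ℝ) : EReal) ≤
            (((∑ j, ((f j).totalDegree : ℕ∞) * V.geomMultiplicity l (f j) : ℕ∞) : ℝ≥0∞)
              : EReal))) :
    V.HasRationalFirstIntegral := by
  by_contra hno
  have hE : V.extactic l ≠ 0 := fun h => hno (V.hasRationalFirstIntegral_of_extactic_eq_zero h)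
  have hle : (((∑ j, ((f j).totalDegree : ℕ∞) * V.geomMultiplicity l (f j) : ℕ∞) : ℝ≥0∞) : EReal)
      ≤ (((V.extactic l).totalDegree : ℝ) : EReal) := by
    have h1 := PlaneVectorField.sum_geomMultiplicity_le (fun j => (hf j).1) hdist hE
    have h2 := EReal.coe_ennreal_le_coe_ennreal_iff.2 (ENat.toENNReal_le.2 h1)
    refine h2.trans (le_of_eq ?_)
    rw [ENat.toENNReal_coe]
    rfl
  obtain ⟨hn, hn'⟩ := PlaneVectorField.totalDegree_extactic_le_nBound hl hE
  rcases hsum with h | ⟨hl2, hinf, h⟩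
  · exact absurd (EReal.coe_lt_coe_iff.1 (h.trans_le hle)) (not_lt.2 hn)
  · exact absurd (EReal.coe_le_coe_iff.1 (h.trans hle)) (not_le.2 (hn' hl2 hinf))
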